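/- Let $p$ and $\ell$ be distinct primes and let $\Phi_\ell(X,Y)\in\mathbb{Z}[X,Y]$ be the classical modular polynomial of level $\ell$, i.e. the unique integral polynomial with $$\Phi_\ell(j(\tau),Y)=\bigl(Y-j(\ell\tau)\bigr)\prod_{k=0}^{\ell-1}\Bigl(Y-j\bigl(\tfrac{\tau+k}{\ell}\bigr)\Bigr)$$ for all $\tau$ in the complex upper half plane, where $j$ is the modular $j$-function. Let $\mathcal{G}_\ell(\overline{\mathbb{F}}_p)$ be the directed multigraph whose vertices are the $j$-invariants of the supersingular elliptic curves over $\overline{\mathbb{F}}_p$, the number of edges from $j_1$ to $j_2$ being the multiplicity of $j_2$ as a root of $\Phi_\ell(j_1,Y)\in\overline{\mathbb{F}}_p[Y]$. Put $$\operatorname{Res}_\ell(X)=\operatorname{Res}_Y\Bigl(\Phi_\ell(X,Y),\ \tfrac{\partial}{\partial Y}\Phi_\ell(X,Y)\Bigr)\in\mathbb{Z}[X].$$ If there is a double edge from $j_1$ to $j_2$ in $\mathcal{G}_\ell(\overline{\mathbb{F}}_p)$ (that is, at least two edges from $j_1$ to $j_2$), then $j_1$ is a root of the reduction of $\operatorname{Res}_\ell$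 modulo $p$. Moreover, $\operatorname{Res}_\ell(X)$ has degree at most $2\ell(2\ell-1)$. -/

import Mathlib

open Polynomial Polynomial.Bivariate UpperHalfPlane

noncomputable section

namespace SupersingularGraph

/-- The classical modular `j`-function `j(τ) = E₄(τ)³ / Δ(τ) = 1/q + 744 + 196884 q + ⋯` on the
upper half plane (`E₄` is normalised to have constant term `1`, and `Δ = q ∏ (1 - qⁿ)²⁴`
vanishes nowhere). -/
def modularJ (τ : ℍ) : ℂ :=
  ModularForm.E₄ τ ^ 3 / ModularForm.discriminant τ

/-- For `Φ ∈ ℤ[X, Y]` and `x` in a commutative ring `K`, the one-variable polynomial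
`Φ(x, Y) ∈ K[Y]`. In `ℤ[X][Y]` the inner variable is `X` and the outer variable is `Y`. -/
def specializeX {K : Type*} [CommRing K] (Φ : ℤ[X][Y]) (x : K) : K[X] :=
  Φ.map (eval₂RingHom (Int.castRingHom K) x)

/-- The classical defining identity of the modular polynomial of prime level `ℓ`:
`Φ(j(τ), Y) = (Y - j(ℓτ)) · ∏_{0 ≤ k < ℓ} (Y - j((τ + k)/ℓ))` for all `τ` in the upper half plane.
The lattices `⟨1, ℓτ⟩` and `⟨1, (τ + k)/ℓ⟩` represent the `ℓ + 1` (cyclic) `ℓ`-isogenies from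
`ℂ/⟨1, τ⟩`. Since `j` takes infinitely many values, at most one `Φ ∈ ℤ[X, Y]` satisfies it.
(`ofComplex` turns a complex number with positive imaginary part into a point of `ℍ`; all the
arguments below have positive imaginary part.) -/
def IsModularPolynomial (ℓ : ℕ) (Φ : ℤ[X][Y]) : Prop :=
  ∀ τ : ℍ, specializeX Φ (modularJ τ) =
    (X - C (modularJ (ofComplex (ℓ * (τ : ℂ))))) *
      ∏ k ∈ Finset.range ℓ, (X - C (modularJ (ofComplex (((τ : ℂ) + k) / ℓ))))

open Classical in
/-- The modular polynomial `Φ_ℓ(X, Y) ∈ ℤ[X, Y]` of prime level `ℓ`: the unique integral polynomial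
satisfying `IsModularPolynomial ℓ`. -/
def modularPolynomial (ℓ : ℕ) : ℤ[X][Y] :=
  if h : ∃ Φ : ℤ[X][Y], IsModularPolynomial ℓ Φ then h.choose else 0

/-- `Res_ℓ(X) = Res_Y(Φ_ℓ(X, Y), ∂Φ_ℓ/∂Y (X, Y)) ∈ ℤ[X]`. -/
def doubleEdgePolynomial (ℓ : ℕ) : ℤ[X] :=
  resultant (modularPolynomial ℓ) (derivative (modularPolynomial ℓ))

open Classical in
/-- An elliptic curve over an algebraically closed field `K` of characteristic `p` is supersingular
if it has no nontrivial `p^k`-torsion, for every `k ≥ 1`. -/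
def IsSupersingular {K : Type*} [Field K] (p : ℕ) (E : WeierstrassCurve K) : Prop :=
  ∀ k : ℕ, 1 ≤ k → ∀ P : E.toAffine.Point, p ^ k • P = 0 → P = 0

/-- `j` is the `j`-invariant of a supersingular elliptic curve over `K`. -/
def IsSupersingularJ {K : Type*} [Field K] (p : ℕ) (j : K) : Prop :=
  ∃ (E : WeierstrassCurve K) (_ : E.IsElliptic), E.j = j ∧ IsSupersingular p E

/-- The vertices of the supersingular isogeny graph over the algebraic closure of `𝔽_p`: the
isomorphism classes of supersingular elliptic curves, labelled by their `j`-invariants. -/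
def Vertex (p : ℕ) [Fact p.Prime] : Type :=
  {j : AlgebraicClosure (ZMod p) // IsSupersingularJ p j}

/-- The number of directed edges from `j₁` to `j₂` in the graph `𝒢_ℓ` over the algebraic closure of
`𝔽_p`: the multiplicity of `j₂` as a root of `Φ_ℓ(j₁, Y)`. -/
def edgeMultiplicity (p : ℕ) [Fact p.Prime] (ℓ : ℕ) (j₁ j₂ : Vertex p) : ℕ :=
  (specializeX (modularPolynomial ℓ) j₁.1).rootMultiplicity j₂.1

/-- There is a double edge (two edges or more) from `j₁` to `j₂`. -/
def HasDoubleEdge (p : ℕ) [Fact p.Prime] (ℓ : ℕ) (j₁ j₂ : Vertex p) : Prop :=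
  2 ≤ edgeMultiplicity p ℓ j₁ j₂

end SupersingularGraph

end

/-! Since `Φ_ℓ` is monic in `Y`, forming the resultant commutes with specialising `X` to `j₁` in
characteristic `p`. The specialised resultant is a product of values of the derivative at the roots
of `Φ_ℓ(j₁, Y)`, and a double root contributes a zero factor (`isRoot_resultant_derivative`).

For the degree, put `X = j(τ)` and let `Im τ → ∞`: the roots `j(ℓτ)` and `j((τ+k)/ℓ)` are `O(j^ℓ)`
and `O(j)`, so the product formula gives `Res_ℓ(j) = O(j^(3ℓ² - ℓ))`. As `j → ∞`, this bounds the
degree (`natDegree_le_of_isBigO`).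

Both arguments need a `Φ_ℓ` that satisfies its defining identity, and most of the file constructs
one. Clearing poles, the product of `Δ(z) Y - E₄(z)³` over the `ℓ + 1` points `z` has coefficients
that are level one forms of weight `12(ℓ+1)` (`heckeProd_S_smul`) with integral `q`-expansions
(`exists_map_eq_prod_jPolynomial`). Such forms are `Δ^(ℓ+1)` times integral polynomials in `j`
(`exists_eq_discriminant_pow_mul`), and the top polynomial is `±1`. -/

noncomputable section

namespace SupersingularGraph

open Filter Asymptotics Function Topology MatrixGroups Manifold ModularForm

/-! ### Behaviour of `j` at the cusp -/

lemma norm_qParam_one (z : ℂ) : ‖Periodic.qParam 1 z‖ = Real.exp (-2 * Real.pi * z.im) := by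
  simpa using Periodic.norm_qParam 1 z

lemma tendsto_E₄_atImInfty : Tendsto ModularForm.E₄ atImInfty (𝓝 1) := by
  have hper := SlashInvariantFormClass.periodic_comp_ofComplex ModularForm.E₄
    one_mem_strictPeriods_SL
  have han := ModularFormClass.analyticAt_cuspFunction_zero ModularForm.E₄ one_pos
    one_mem_strictPeriods_SL
  have h0 := qExpansion_coeff_zero one_pos han hper
  rw [EisensteinSeries.E_qExpansion_coeff_zero (by norm_num) (by decide)] at h0
  have h1 := han.continuousAt.tendsto.comp (qParam_tendsto_atImInfty one_pos)
  rw [cuspFunction_apply_zero one_pos han hper, ← h0] at h1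
  exact h1.congr fun τ ↦ eq_cuspFunction τ one_ne_zero hper

lemma tendsto_discriminant_div_qParam :
    Tendsto (fun τ : ℍ ↦ ModularForm.discriminant τ / Periodic.qParam 1 τ) atImInfty (𝓝 1) :=
  ModularForm.tendsto_atImInfty_tprod_one_sub_eta_q_pow.congr fun τ ↦ by
    rw [ModularForm.discriminant_eq_q_prod, mul_div_cancel_left₀ _ (Periodic.qParam_ne_zero _)]

lemma tendsto_modularJ_mul_qParam :
    Tendsto (fun τ : ℍ ↦ modularJ τ * Periodic.qParam 1 τ) atImInfty (𝓝 1) := by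
  have h := (tendsto_E₄_atImInfty.pow 3).div tendsto_discriminant_div_qParam one_ne_zero
  simp only [one_pow, div_one] at h
  refine h.congr fun τ ↦ ?_
  simp only [Pi.div_apply, modularJ]
  field_simp

/-- Comparison with a function of `Im τ` alone makes `j(ℓτ)` and `j((τ+k)/ℓ)` comparable with
`j(τ)`. -/
lemma isTheta_modularJ :
    modularJ =Θ[atImInfty] fun τ : ℍ ↦ Real.exp (2 * Real.pi * τ.im) := by
  have h : (fun τ : ℍ ↦ modularJ τ * Periodic.qParam 1 τ) =Θ[atImInfty] fun _ ↦ (1 : ℝ) := by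
    have h1 := (isEquivalent_const_iff_tendsto (one_ne_zero (α := ℂ))).2
      tendsto_modularJ_mul_qParam
    exact h1.isTheta.trans (IsTheta.of_norm_eventuallyEq (by simp))
  have h2 : (fun τ : ℍ ↦ (Periodic.qParam 1 (τ : ℂ))⁻¹) =Θ[atImInfty]
      fun τ : ℍ ↦ Real.exp (2 * Real.pi * τ.im) := by
    refine IsTheta.of_norm_eventuallyEq (.of_forall fun τ ↦ ?_)
    simp [norm_qParam_one, ← Real.exp_neg]
  have h3 := h.mul h2
  simpa [mul_assoc, Periodic.qParam_ne_zero] using h3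

lemma tendsto_exp_im_atImInfty :
    Tendsto (fun τ : ℍ ↦ Real.exp (2 * Real.pi * τ.im)) atImInfty atTop :=
  Real.tendsto_exp_atTop.comp
    ((tendsto_comap : Tendsto UpperHalfPlane.im atImInfty atTop).const_mul_atTop (by positivity))

lemma tendsto_norm_modularJ : Tendsto (fun τ ↦ ‖modularJ τ‖) atImInfty atTop := by
  exact isTheta_modularJ.tendsto_norm_atTop_iff.2
    (tendsto_norm_atTop_atTop.comp tendsto_exp_im_atImInfty)

instance : NeBot atImInfty := by
  unfold atImInfty
  refine comap_neBot fun s hs ↦ ?_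
  obtain ⟨A, hA⟩ := mem_atTop_sets.1 hs
  exact ⟨⟨(max A 1 : ℝ) * Complex.I, by simp⟩, hA _ (by simp [UpperHalfPlane.im])⟩

/-- `j` takes infinitely many values. -/
lemma infinite_range_modularJ : (Set.range modularJ).Infinite := by
  intro hfin
  obtain ⟨B, hB⟩ := hfin.isBounded.exists_norm_le
  obtain ⟨τ, hτ⟩ := (tendsto_norm_modularJ.eventually_gt_atTop B).exists
  exact absurd (hB _ ⟨τ, rfl⟩) (not_le.2 hτ)

/-- A polynomial over `ℤ` is determined by its values at the values of `j`. -/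
lemma eq_of_eval₂_modularJ_eq {P Q : ℤ[X]}
    (h : ∀ τ, P.eval₂ (Int.castRingHom ℂ) (modularJ τ) = Q.eval₂ (Int.castRingHom ℂ) (modularJ τ)) :
    P = Q := by
  apply Polynomial.map_injective (Int.castRingHom ℂ) (Int.cast_injective (α := ℂ))
  refine eq_of_infinite_eval_eq _ _ (infinite_range_modularJ.mono ?_)
  rintro _ ⟨τ, rfl⟩
  simpa [eval_map] using h τ

/-- A polynomial whose value at `f` is `O(f ^ n)` while `f → ∞` has degree at most `n`. -/
lemma natDegree_le_of_isBigO {α : Type*} {l : Filter α} [NeBot l] {f : α → ℂ}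
    (hf : Tendsto (fun a ↦ ‖f a‖) l atTop) {P : ℂ[X]} {n : ℕ}
    (h : (fun a ↦ P.eval (f a)) =O[l] fun a ↦ f a ^ n) : P.natDegree ≤ n := by
  by_contra! hn
  have hinv : Tendsto (fun a ↦ (f a)⁻¹) l (𝓝 0) :=
    tendsto_inv₀_cobounded.comp (tendsto_norm_atTop_iff_cobounded.1 hf)
  have hne : ∀ᶠ a in l, f a ≠ 0 := (hf.eventually_gt_atTop 0).mono fun a ha ↦ norm_pos_iff.1 ha
  -- `P(f) = f^deg P · reverse P (1/f)`. If `n < deg P`, the bound forces `reverse P (1/f) = O(1/f)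
  -- → 0`, so the leading coefficient vanishes.
  have h1 : Tendsto (fun a ↦ P.reverse.eval (f a)⁻¹) l (𝓝 P.leadingCoeff) := by
    have := (P.reverse.continuous.tendsto 0).comp hinv
    rwa [← coeff_zero_eq_eval_zero, coeff_zero_reverse] at this
  have h2 : (fun a ↦ P.reverse.eval (f a)⁻¹) =O[l] fun a ↦ (f a)⁻¹ := by
    have h3 := h.mul (isBigO_refl (fun a ↦ ((f a) ^ P.natDegree)⁻¹) l)
    refine (h3.congr' ?_ .rfl).trans ?_
    · filter_upwards [hne] with a ha
      let := invertibleOfNonzero ha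
      have := eval₂_reverse_mul_pow (RingHom.id ℂ) (f a) P
      rw [invOf_eq_inv] at this
      rw [← eval₂_id, ← eval₂_id, ← this, mul_inv_cancel_right₀ (pow_ne_zero _ ha)]
    · refine IsBigO.of_bound 1 ?_
      filter_upwards [hf.eventually_ge_atTop 1, hne] with a ha ha'
      simp only [norm_mul, norm_inv, norm_pow, one_mul]
      have h0 : 0 < ‖f a‖ := by linarith
      rw [← div_eq_mul_inv, div_le_iff₀ (by positivity), inv_mul_eq_div, le_div_iff₀ h0, ← pow_succ]
      exact pow_le_pow_right₀ ha hn
  have h4 := tendsto_nhds_unique h1 (h2.trans_tendsto hinv)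
  rw [leadingCoeff_eq_zero.1 h4] at hn
  simp at hn

/-! ### The points `ℓτ` and `(τ + k) / ℓ` -/

lemma coe_ofComplex_mul {ℓ : ℕ} (hℓ : 0 < ℓ) (τ : ℍ) :
    (ofComplex (ℓ * (τ : ℂ)) : ℂ) = ℓ * (τ : ℂ) := by
  rw [ofComplex_apply_of_im_pos (by simpa [hℓ] using τ.im_pos)]

lemma coe_ofComplex_add_div {ℓ : ℕ} (hℓ : 0 < ℓ) (τ : ℍ) (k : ℕ) :
    (ofComplex (((τ : ℂ) + k) / ℓ) : ℂ) = ((τ : ℂ) + k) / ℓ := by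
  rw [ofComplex_apply_of_im_pos]
  simpa using div_pos τ.im_pos (Nat.cast_pos.2 hℓ)

lemma im_ofComplex_mul {ℓ : ℕ} (hℓ : 0 < ℓ) (τ : ℍ) :
    (ofComplex (ℓ * (τ : ℂ))).im = ℓ * τ.im := by
  rw [← coe_im, coe_ofComplex_mul hℓ]; simp

lemma im_ofComplex_add_div {ℓ : ℕ} (hℓ : 0 < ℓ) (τ : ℍ) (k : ℕ) :
    (ofComplex (((τ : ℂ) + k) / ℓ)).im = τ.im / ℓ := by
  rw [← coe_im, coe_ofComplex_add_div hℓ]; simp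

lemma tendsto_ofComplex_mul {ℓ : ℕ} (hℓ : 0 < ℓ) :
    Tendsto (fun τ : ℍ ↦ ofComplex (ℓ * (τ : ℂ))) atImInfty atImInfty := by
  refine tendsto_comap_iff.2 ?_
  simp only [Function.comp_def, im_ofComplex_mul hℓ]
  exact (tendsto_comap : Tendsto UpperHalfPlane.im atImInfty atTop).const_mul_atTop (by positivity)

lemma tendsto_ofComplex_add_div {ℓ : ℕ} (hℓ : 0 < ℓ) (k : ℕ) :
    Tendsto (fun τ : ℍ ↦ ofComplex (((τ : ℂ) + k) / ℓ)) atImInfty atImInfty := by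
  refine tendsto_comap_iff.2 ?_
  simp only [Function.comp_def, im_ofComplex_add_div hℓ]
  exact (tendsto_comap : Tendsto UpperHalfPlane.im atImInfty atTop).atTop_div_const (by positivity)

lemma isBigO_one_modularJ : (fun _ : ℍ ↦ (1 : ℂ)) =O[atImInfty] modularJ := by
  refine IsBigO.of_bound 1 ?_
  filter_upwards [tendsto_norm_modularJ.eventually_ge_atTop 1] with τ hτ
  simpa using hτ

lemma isBigO_modularJ_mul {ℓ : ℕ} (hℓ : 0 < ℓ) :
    (fun τ : ℍ ↦ modularJ (ofComplex (ℓ * (τ : ℂ)))) =O[atImInfty] fun τ ↦ modularJ τ ^ ℓ := by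
  refine (isTheta_modularJ.isBigO.comp_tendsto (tendsto_ofComplex_mul hℓ)).trans ?_
  refine IsBigO.trans (.of_bound 1 (.of_forall fun τ ↦ (Eq.le ?_))) (isTheta_modularJ.isBigO_symm.pow ℓ)
  simp only [Function.comp_def, im_ofComplex_mul hℓ, ← Real.exp_nat_mul, one_mul]
  ring_nf

lemma isBigO_modularJ_add_div {ℓ : ℕ} (hℓ : 0 < ℓ) (k : ℕ) :
    (fun τ : ℍ ↦ modularJ (ofComplex (((τ : ℂ) + k) / ℓ))) =O[atImInfty] modularJ := by
  refine (isTheta_modularJ.isBigO.comp_tendsto (tendsto_ofComplex_add_div hℓ k)).trans ?_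
  refine IsBigO.trans (.of_bound 1 (.of_forall fun τ ↦ ?_)) isTheta_modularJ.isBigO_symm
  simp only [Function.comp_def, im_ofComplex_add_div hℓ, Real.norm_eq_abs, Real.abs_exp, one_mul,
    Real.exp_le_exp]
  have : τ.im / ℓ ≤ τ.im := div_le_self τ.im_pos.le (by exact_mod_cast hℓ)
  gcongr

/-! ### Double roots and the resultant with the derivative -/

/-- A double root of a specialisation of a monic `Φ` is a zero of `Res_Y(Φ, ∂Φ/∂Y)`. -/
lemma isRoot_resultant_derivative {K : Type*} [Field K] [IsAlgClosed K] {Φ : ℤ[X][Y]}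
    (hΦ : Φ.Monic) {x y : K} (h : 2 ≤ (specializeX Φ x).rootMultiplicity y) :
    ((resultant Φ (derivative Φ)).map (Int.castRingHom K)).IsRoot x := by
  set f := specializeX Φ x with hf
  have hfm : f.Monic := hΦ.map _
  have hdeg : f.natDegree = Φ.natDegree := hΦ.natDegree_map _
  have hroot : f.IsRoot y := (rootMultiplicity_pos hfm.ne_zero).1 (by omega)
  have hroot' : (derivative f).IsRoot y :=
    (one_lt_rootMultiplicity_iff_isRoot hfm.ne_zero).1 (by omega) |>.2
  have hder : derivative f = (derivative Φ).map (eval₂RingHom (Int.castRingHom K) x) := by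
    rw [hf, specializeX, derivative_map]
  -- The degree of the derivative can drop in `K`; the resultant keeps the formal degree of
  -- `derivative Φ`, and the product formula over the roots of the monic `f` still applies.
  rw [IsRoot.def, eval_map, ← coe_eval₂RingHom, ← resultant_map_map, ← hder, ← hdeg]
  change resultant f (derivative f) f.natDegree _ = 0
  rw [resultant_eq_prod_eval f (derivative f) _ (hder ▸ natDegree_map_le) (IsAlgClosed.splits f)]
  refine mul_eq_zero_of_right _ (Multiset.prod_eq_zero ?_)
  exact Multiset.mem_map.2 ⟨y, (mem_roots hfm.ne_zero).2 hroot, hroot'⟩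

/-! ### Degree of the resultant -/

lemma IsModularPolynomial.specializeX_natDegree {ℓ : ℕ} {Φ : ℤ[X][Y]}
    (hΦ : IsModularPolynomial ℓ Φ) (τ : ℍ) :
    (specializeX Φ (modularJ τ)).Monic ∧
      (specializeX Φ (modularJ τ)).natDegree = ℓ + 1 := by
  rw [hΦ τ]
  have h1 := monic_X_sub_C (modularJ (ofComplex (ℓ * (τ : ℂ))))
  have h2 := monic_prod_X_sub_C (fun k : ℕ ↦ modularJ (ofComplex (((τ : ℂ) + k) / ℓ)))
    (Finset.range ℓ)
  refine ⟨h1.mul h2, ?_⟩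
  rw [h1.natDegree_mul h2, natDegree_X_sub_C, natDegree_finsetProd_X_sub_C_eq_card]
  simp [add_comm]

/-- Each coefficient lies in `ℤ[X]` and is determined by its values at the infinitely many `j(τ)`,
where `Φ` becomes a product of `ℓ + 1` monic linear factors. -/
lemma IsModularPolynomial.monic {ℓ : ℕ} {Φ : ℤ[X][Y]} (hΦ : IsModularPolynomial ℓ Φ) :
    Φ.Monic ∧ Φ.natDegree = ℓ + 1 := by
  have hcoeff (n : ℕ) (τ : ℍ) : (Φ.coeff n).eval₂ (Int.castRingHom ℂ) (modularJ τ) =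
      (specializeX Φ (modularJ τ)).coeff n := by
    simp [specializeX, coeff_map]
  have hlead : Φ.coeff (ℓ + 1) = 1 := eq_of_eval₂_modularJ_eq fun τ ↦ by
    obtain ⟨h1, h2⟩ := hΦ.specializeX_natDegree τ
    rw [hcoeff, ← h2, h1.coeff_natDegree, eval₂_one]
  have hdeg : Φ.natDegree = ℓ + 1 := by
    refine le_antisymm (natDegree_le_iff_coeff_eq_zero.2 fun n hn ↦ ?_)
      (le_natDegree_of_ne_zero (by simp [hlead]))
    refine eq_of_eval₂_modularJ_eq fun τ ↦ ?_
    rw [hcoeff, eval₂_zero, coeff_eq_zero_of_natDegree_lt]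
    rwa [(hΦ.specializeX_natDegree τ).2]
  exact ⟨by rw [Monic, leadingCoeff, hdeg, hlead], hdeg⟩

/-- The resultant of `(X - a) ∏ (X - b k)` and its derivative. -/
lemma resultant_derivative_X_sub_C_mul_prod (a : ℂ) (b : ℕ → ℂ) (m n : ℕ)
    (hn : (derivative ((X - C a) * ∏ k ∈ Finset.range m, (X - C (b k)))).natDegree ≤ n) :
    resultant ((X - C a) * ∏ k ∈ Finset.range m, (X - C (b k)))
      (derivative ((X - C a) * ∏ k ∈ Finset.range m, (X - C (b k)))) (m + 1) n =
    (∏ k ∈ Finset.range m, (a - b k)) * ∏ k ∈ Finset.range m, ((b k - a) *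
      ∑ i ∈ Finset.range m, ∏ j ∈ (Finset.range m).erase i, (b k - b j)) := by
  set g := ∏ k ∈ Finset.range m, (X - C (b k)) with hg
  have hgm : g.Monic := monic_prod_X_sub_C b _
  have hgdeg : g.natDegree = m := by simp [hg, natDegree_finsetProd_X_sub_C_eq_card]
  have h1 := resultant_mul_left (X - C a) g (derivative ((X - C a) * g)) n hn
  rw [natDegree_X_sub_C, hgdeg] at h1
  have h2 := resultant_prod_left (Finset.range m) (fun k ↦ X - C (b k))
    (derivative ((X - C a) * g)) n (by simp) hn
  simp only [natDegree_X_sub_C, ← hg, hgdeg] at h2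
  -- The resultant is multiplicative on the left and `Res(X - c, h) = h(c)`. With `g = ∏ (X - b k)`,
  -- the derivative of `(X - a) g` is `g(a)` at `a` and `(b k - a) g'(b k)` at `b k`.
  rw [add_comm m 1, h1, h2, resultant_X_sub_C_left _ _ _ hn]
  have hga : g.eval a = ∏ k ∈ Finset.range m, (a - b k) := by simp [hg, eval_prod]
  have hgb (k : ℕ) (hk : k ∈ Finset.range m) : g.eval (b k) = 0 := by
    rw [hg, eval_prod]
    exact Finset.prod_eq_zero hk (by simp)
  have hg' (k : ℕ) : (derivative g).eval (b k) =
      ∑ i ∈ Finset.range m, ∏ j ∈ (Finset.range m).erase i, (b k - b j) := by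
    simp [hg, derivative_prod_finset, eval_finsetSum, eval_prod]
  congr 1
  · simp [derivative_mul, hga]
  · refine Finset.prod_congr rfl fun k hk ↦ ?_
    rw [resultant_X_sub_C_left _ _ _ hn]
    simp [derivative_mul, hgb k hk, hg']

/-- The `ℓ` factors `a - b k` give `j^(ℓ·ℓ)`; each `k` contributes a further `b k - a = O(j^ℓ)` and
a sum of products of `ℓ - 1` differences, each `O(j)`. -/
lemma IsModularPolynomial.natDegree_resultant_le {ℓ : ℕ} (hℓ : 0 < ℓ) {Φ : ℤ[X][Y]}
    (hΦ : IsModularPolynomial ℓ Φ) :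
    (resultant Φ (derivative Φ)).natDegree ≤ ℓ * ℓ + ℓ * (ℓ + (ℓ - 1)) := by
  rw [← natDegree_map_eq_of_injective (f := Int.castRingHom ℂ) Int.cast_injective]
  refine natDegree_le_of_isBigO tendsto_norm_modularJ ?_
  let a : ℍ → ℂ := fun τ ↦ modularJ (ofComplex (ℓ * (τ : ℂ)))
  let b : ℕ → ℍ → ℂ := fun k τ ↦ modularJ (ofComplex (((τ : ℂ) + k) / ℓ))
  have hval (τ : ℍ) : ((resultant Φ (derivative Φ)).map (Int.castRingHom ℂ)).eval (modularJ τ) =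
      (∏ k ∈ Finset.range ℓ, (a τ - b k τ)) * ∏ k ∈ Finset.range ℓ, ((b k τ - a τ) *
        ∑ i ∈ Finset.range ℓ, ∏ j ∈ (Finset.range ℓ).erase i, (b k τ - b j τ)) := by
    have hder : (derivative Φ).map (eval₂RingHom (Int.castRingHom ℂ) (modularJ τ)) =
      derivative (Φ.map (eval₂RingHom (Int.castRingHom ℂ) (modularJ τ))) := (derivative_map _ _).symm
    have hτ : Φ.map (eval₂RingHom (Int.castRingHom ℂ) (modularJ τ)) = _ := hΦ τ
    rw [eval_map, ← coe_eval₂RingHom, ← resultant_map_map, hΦ.monic.2, hder, hτ,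
      resultant_derivative_X_sub_C_mul_prod _ (fun k ↦ b k τ)]
    rw [← hτ, ← hder]
    exact natDegree_map_le
  simp_rw [hval]
  have ha : a =O[atImInfty] fun τ ↦ modularJ τ ^ ℓ := isBigO_modularJ_mul hℓ
  have hb (k : ℕ) : b k =O[atImInfty] modularJ := isBigO_modularJ_add_div hℓ k
  have hb' (k : ℕ) : b k =O[atImInfty] fun τ ↦ modularJ τ ^ ℓ := by
    refine (hb k).trans ?_
    obtain ⟨m, rfl⟩ : ∃ m, ℓ = m + 1 := ⟨ℓ - 1, by omega⟩
    simpa [pow_succ] using (isBigO_one_modularJ.pow m).mul (isBigO_refl modularJ atImInfty)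
  have h1 : (fun τ ↦ ∏ k ∈ Finset.range ℓ, (a τ - b k τ)) =O[atImInfty]
      fun τ ↦ modularJ τ ^ (ℓ * ℓ) := by
    have := IsBigO.finsetProd (s := Finset.range ℓ) fun k _ ↦ ha.sub (hb' k)
    simpa [← pow_mul] using this
  have h2 (k : ℕ) : (fun τ ↦ ∑ i ∈ Finset.range ℓ, ∏ j ∈ (Finset.range ℓ).erase i,
      (b k τ - b j τ)) =O[atImInfty] fun τ ↦ modularJ τ ^ (ℓ - 1) := by
    refine IsBigO.fun_sum fun i hi ↦ ?_
    have := IsBigO.finsetProd (s := (Finset.range ℓ).erase i) fun j _ ↦ (hb k).sub (hb j)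
    simpa [Finset.card_erase_of_mem hi] using this
  have h3 := IsBigO.finsetProd (s := Finset.range ℓ) fun k _ ↦ ((hb' k).sub ha).mul (h2 k)
  have h4 := h1.mul h3
  simp only [Finset.prod_const, Finset.card_range, ← pow_add, ← pow_mul] at h4
  rwa [mul_comm (ℓ + (ℓ - 1)) ℓ] at h4

lemma IsModularPolynomial.natDegree_resultant_le' {ℓ : ℕ} (hℓ : 0 < ℓ) {Φ : ℤ[X][Y]}
    (hΦ : IsModularPolynomial ℓ Φ) :
    (resultant Φ (derivative Φ)).natDegree ≤ 2 * ℓ * (2 * ℓ - 1) := by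
  refine (hΦ.natDegree_resultant_le hℓ).trans ?_
  obtain ⟨m, rfl⟩ : ∃ m, ℓ = m + 1 := ⟨ℓ - 1, by omega⟩
  simp only [Nat.add_sub_cancel, show 2 * (m + 1) - 1 = 2 * m + 1 by omega]
  -- `3ℓ² - ℓ ≤ 4ℓ² - 2ℓ` amounts to `ℓ ≤ ℓ²`.
  nlinarith

/-! ### Functions with an integral `q`-expansion -/

/-- `f` is the sum on `ℍ` of the `q`-series with integer coefficients `a`. -/
def HasIntegralQSeries (f : ℍ → ℂ) (a : PowerSeries ℤ) : Prop :=
  ∀ τ : ℍ, HasSum (fun n ↦ (a.coeff n : ℂ) * Periodic.qParam 1 (τ : ℂ) ^ n) (f τ)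

namespace HasIntegralQSeries

variable {f g : ℍ → ℂ} {a b : PowerSeries ℤ}

lemma add (hf : HasIntegralQSeries f a) (hg : HasIntegralQSeries g b) :
    HasIntegralQSeries (f + g) (a + b) := fun τ ↦ by
  simpa [add_mul] using (hf τ).add (hg τ)

lemma neg (hf : HasIntegralQSeries f a) : HasIntegralQSeries (-f) (-a) := fun τ ↦ by
  simpa using (hf τ).neg

lemma mul (hf : HasIntegralQSeries f a) (hg : HasIntegralQSeries g b) :
    HasIntegralQSeries (f * g) (a * b) := fun τ ↦ by
  have h1 := (hf τ).summable.norm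
  have h2 := (hg τ).summable.norm
  have h3 := tsum_mul_tsum_eq_tsum_sum_antidiagonal_of_summable_norm h1 h2
  have h4 := (summable_norm_sum_mul_antidiagonal_of_summable_norm h1 h2).of_norm.hasSum
  rw [← h3, (hf τ).tsum_eq, (hg τ).tsum_eq] at h4
  convert! h4 using 2 with n
  rw [PowerSeries.coeff_mul, Int.cast_sum, Finset.sum_mul]
  refine Finset.sum_congr rfl fun kl hkl ↦ ?_
  rw [← Finset.HasAntidiagonal.mem_antidiagonal.1 hkl, Int.cast_mul, pow_add]
  ring

lemma zero : HasIntegralQSeries 0 0 := fun τ ↦ by simp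

lemma one : HasIntegralQSeries 1 1 := fun τ ↦ by
  convert! hasSum_ite_eq (0 : ℕ) (1 : ℂ) using 2 with n
  rcases eq_or_ne n 0 with rfl | h <;> simp [PowerSeries.coeff_one, *]

lemma pow (hf : HasIntegralQSeries f a) (n : ℕ) : HasIntegralQSeries (f ^ n) (a ^ n) := by
  induction n with
  | zero => simpa using .one
  | succ n ih => simpa only [pow_succ] using ih.mul hf

lemma isBoundedAtImInfty (hf : HasIntegralQSeries f a) : IsBoundedAtImInfty f :=
  isBoundedAtImInfty_of_hasSum_qExpansion one_pos hf

lemma vadd_one (hf : HasIntegralQSeries f a) (τ : ℍ) : f ((1 : ℝ) +ᵥ τ) = f τ := by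
  refine (hf _).unique ?_
  have : Periodic.qParam 1 (((1 : ℝ) +ᵥ τ : ℍ) : ℂ) = Periodic.qParam 1 (τ : ℂ) := by
    simp [Periodic.qParam, mul_add, Complex.exp_add]
  have h := hf τ
  rwa [← this] at h

/-- Every real `q` in `(0, 1)` comes from a point of `ℍ`, so the series converges there. Its radius
of convergence is thus at least `1`, and `f` is a holomorphic function of `q`. -/
lemma mdifferentiable (hf : HasIntegralQSeries f a) : MDiff f := by
  let p : FormalMultilinearSeries ℂ ℂ ℂ := .ofScalars ℂ fun n ↦ (a.coeff n : ℂ)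
  have hp : 1 ≤ p.radius := by
    refine le_of_forall_lt_imp_le_of_dense fun r hr ↦ ?_
    rcases eq_or_ne r 0 with rfl | hr'
    · simp
    lift r to NNReal using hr.ne_top
    have hr0 : ((r : ℝ) : ℂ) ≠ 0 := by simpa using hr'
    have him := Periodic.im_invQParam_pos_of_norm_lt_one (q := ((r : ℝ) : ℂ)) one_pos
      (by simpa using hr) hr0
    have := (hf ⟨_, him⟩).summable.norm
    apply FormalMultilinearSeries.le_radius_of_summable
    simpa [p, FormalMultilinearSeries.norm_apply_eq_norm_coef,
      FormalMultilinearSeries.coeff_ofScalars, Periodic.qParam_right_inv one_ne_zero hr0] using this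
  have hF : DifferentiableOn ℂ p.sum (Metric.eball 0 1) := fun z hz ↦
    ((p.hasFPowerSeriesOnBall (one_pos.trans_le hp)).differentiableOn.mono
      (Metric.eball_subset_eball hp)) z hz
  have hfF (τ : ℍ) : f τ = p.sum (Periodic.qParam 1 (τ : ℂ)) := by
    rw [← (hf τ).tsum_eq, FormalMultilinearSeries.sum]
    refine tsum_congr fun n ↦ ?_
    simp [p, mul_comm]
  rw [UpperHalfPlane.mdifferentiable_iff]
  have hq (z : ℂ) (hz : 0 < z.im) : Periodic.qParam 1 z ∈ Metric.eball (0 : ℂ) 1 := by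
    rw [← ENNReal.coe_one, Metric.eball_coe, NNReal.coe_one, mem_ball_zero_iff]
    exact Periodic.norm_qParam_lt_one one_pos hz
  refine (hF.comp Periodic.differentiable_qParam.differentiableOn hq).congr fun z hz ↦ ?_
  simp [ofComplex_apply_of_im_pos hz, hfF]

end HasIntegralQSeries

/-- The ring of functions on `ℍ` with an integral `q`-expansion. -/
def integralQSeries : Subring (ℍ → ℂ) where
  carrier := {f | ∃ a, HasIntegralQSeries f a}
  add_mem' := fun ⟨_, hf⟩ ⟨_, hg⟩ ↦ ⟨_, hf.add hg⟩
  mul_mem' := fun ⟨_, hf⟩ ⟨_, hg⟩ ↦ ⟨_, hf.mul hg⟩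
  neg_mem' := fun ⟨_, hf⟩ ↦ ⟨_, hf.neg⟩
  zero_mem' := ⟨_, .zero⟩
  one_mem' := ⟨_, .one⟩

/-- Evaluation of functions with an integral `q`-expansion at a point. -/
def evalAt (τ : ℍ) : integralQSeries →+* ℂ :=
  (Pi.evalRingHom (fun _ : ℍ ↦ ℂ) τ).comp integralQSeries.subtype

@[simp] lemma evalAt_apply (τ : ℍ) (f : integralQSeries) : evalAt τ f = f.1 τ := rfl

/-! ### Integrality of the `q`-expansions of `E₄`, `E₆` and `Δ`. -/

lemma hasIntegralQSeries_of_coeff {k : ℤ} (f : ModularForm 𝒮ℒ k) {a : PowerSeries ℤ}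
    (h : ∀ n, (qExpansion 1 f).coeff n = a.coeff n) : HasIntegralQSeries f a := fun τ ↦ by
  simpa [h] using ModularForm.hasSum_qExpansion f one_pos one_mem_strictPeriods_SL τ

lemma HasIntegralQSeries.qExpansion_coeff {k : ℤ} {f : ModularForm 𝒮ℒ k} {a : PowerSeries ℤ}
    (h : HasIntegralQSeries f a) (n : ℕ) : (qExpansion 1 f).coeff n = a.coeff n :=
  (ModularFormClass.qExpansion_coeff_unique one_pos one_mem_strictPeriods_SL h n).symm

/-- The `q`-series `∑_{n ≥ 1} σ_k(n) qⁿ`. -/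
def sigmaSeries (k : ℕ) : PowerSeries ℤ := .mk fun n ↦ (ArithmeticFunction.sigma k n : ℤ)

lemma hasIntegralQSeries_E₄ : HasIntegralQSeries ModularForm.E₄ (1 + 240 * sigmaSeries 3) := by
  refine hasIntegralQSeries_of_coeff _ fun n ↦ ?_
  rw [EisensteinSeries.E_qExpansion_coeff _ ⟨2, rfl⟩, map_add, PowerSeries.coeff_one,
    ← map_ofNat (PowerSeries.C (R := ℤ)) 240, PowerSeries.coeff_C_mul]
  norm_num [sigmaSeries, show _root_.bernoulli 4 = -1 / 30 by decide +kernel]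
  rcases eq_or_ne n 0 with rfl | h <;> simp [*]

lemma hasIntegralQSeries_E₆ : HasIntegralQSeries ModularForm.E₆ (1 - 504 * sigmaSeries 5) := by
  refine hasIntegralQSeries_of_coeff _ fun n ↦ ?_
  rw [EisensteinSeries.E_qExpansion_coeff _ ⟨3, rfl⟩, map_sub, PowerSeries.coeff_one,
    ← map_ofNat (PowerSeries.C (R := ℤ)) 504, PowerSeries.coeff_C_mul]
  norm_num [sigmaSeries, show _root_.bernoulli 6 = 1 / 42 by decide +kernel]
  rcases eq_or_ne n 0 with rfl | h <;> simp [*]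

/-- Holds divisor by divisor, as `d³ ≡ d⁵` modulo `12`. It is the divisibility that makes `(E₄³ -
E₆²) / 1728` integral. -/
lemma twelve_dvd_sigma (n : ℕ) :
    (12 : ℤ) ∣ 5 * (ArithmeticFunction.sigma 3 n : ℤ) + 7 * (ArithmeticFunction.sigma 5 n : ℤ) := by
  simp only [ArithmeticFunction.sigma_apply, Nat.cast_sum, Finset.mul_sum, ← Finset.sum_add_distrib]
  refine Finset.dvd_sum fun d _ ↦ ?_
  have h : ∀ x : ZMod 12, 5 * x ^ 3 + 7 * x ^ 5 = 0 := by decide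
  have := (ZMod.intCast_zmod_eq_zero_iff_dvd (5 * (d : ℤ) ^ 3 + 7 * (d : ℤ) ^ 5) 12).1
    (by push_cast; exact h d)
  exact_mod_cast this

lemma exists_hasIntegralQSeries_discriminant :
    ∃ a, HasIntegralQSeries ModularForm.discriminant a := by
  choose c hc using twelve_dvd_sigma
  set x := sigmaSeries 3 with hx
  set y := sigmaSeries 5 with hy
  have hxy : 5 * x + 7 * y = 12 * PowerSeries.mk c := by
    ext n
    rw [map_add, ← map_ofNat (PowerSeries.C (R := ℤ)) 5, ← map_ofNat (PowerSeries.C (R := ℤ)) 7,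
      ← map_ofNat (PowerSeries.C (R := ℤ)) 12, PowerSeries.coeff_C_mul, PowerSeries.coeff_C_mul,
      PowerSeries.coeff_C_mul]
    simp [hx, hy, sigmaSeries, hc]
  -- The expansion of `(E₄³ - E₆²) / 1728`; its linear part is `144 (5x + 7y) / 1728 = (5x + 7y) /
  -- 12`.
  let a : PowerSeries ℤ := PowerSeries.mk c + 100 * x ^ 2 + 8000 * x ^ 3 - 147 * y ^ 2
  have ha : (1 + 240 * x) * (1 + 240 * x) * (1 + 240 * x) - (1 - 504 * y) * (1 - 504 * y) =
      1728 * a := by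
    simp only [a]
    linear_combination 144 * hxy
  refine ⟨a, fun τ ↦ ?_⟩
  have h := ((hasIntegralQSeries_E₄.mul hasIntegralQSeries_E₄).mul hasIntegralQSeries_E₄).add
    (hasIntegralQSeries_E₆.mul hasIntegralQSeries_E₆).neg
  rw [← hx, ← hy, ← sub_eq_add_neg, ← sub_eq_add_neg, ha] at h
  have h2 := (h τ).div_const 1728
  rw [ModularForm.discriminant_eq_E₄_cube_sub_E₆_sq]
  convert! h2 using 1
  · ext n
    rw [← map_ofNat (PowerSeries.C (R := ℤ)) 1728, PowerSeries.coeff_C_mul]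
    push_cast
    ring
  · simp [pow_succ]

/-- If `f` has an integral `q`-expansion, so does `τ ↦ f(ℓτ)`. -/
lemma comp_mul_mem_integralQSeries {f : ℍ → ℂ} (hf : f ∈ integralQSeries) {ℓ : ℕ} (hℓ : 0 < ℓ) :
    (fun τ : ℍ ↦ f (ofComplex (ℓ * (τ : ℂ)))) ∈ integralQSeries := by
  obtain ⟨a, ha⟩ := hf
  refine ⟨PowerSeries.mk fun n ↦ if ℓ ∣ n then a.coeff (n / ℓ) else 0, fun τ ↦ ?_⟩
  have hinj : Injective fun n : ℕ ↦ ℓ * n := fun _ _ h ↦ Nat.eq_of_mul_eq_mul_left hℓ h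
  rw [← hinj.hasSum_iff]
  · convert! ha (ofComplex (ℓ * (τ : ℂ))) using 2 with n
    have : Periodic.qParam 1 (ℓ * (τ : ℂ)) = Periodic.qParam 1 (τ : ℂ) ^ ℓ := by
      simp only [Periodic.qParam, ← Complex.exp_nat_mul]
      ring_nf
    simp [coe_ofComplex_mul hℓ, this, pow_mul, hℓ]
  · intro n hn
    have : ¬ ℓ ∣ n := fun ⟨m, hm⟩ ↦ hn ⟨m, hm.symm⟩
    simp [this]

/-- Splitting an integral `q`-series according to the residues of the exponents modulo `ℓ`. -/
lemma exists_residue_decomposition {f : ℍ → ℂ} (hf : f ∈ integralQSeries) (ℓ : ℕ) [NeZero ℓ] :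
    ∃ F : ZMod ℓ → integralQSeries, ∀ τ z : ℍ,
      Periodic.qParam 1 (z : ℂ) ^ ℓ = Periodic.qParam 1 (τ : ℂ) →
      f z = ∑ i, (F i).1 τ * Periodic.qParam 1 (z : ℂ) ^ i.val := by
  obtain ⟨a, ha⟩ := hf
  have hℓ : 0 < ℓ := NeZero.pos ℓ
  have hsum (i : ZMod ℓ) (τ z : ℍ)
      (h : Periodic.qParam 1 (z : ℂ) ^ ℓ = Periodic.qParam 1 (τ : ℂ)) :
      Summable fun n ↦ (a.coeff (i.val + ℓ * n) : ℂ) * Periodic.qParam 1 (τ : ℂ) ^ n := by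
    have hinj : Injective fun n : ℕ ↦ i.val + ℓ * n := fun _ _ h ↦
      Nat.eq_of_mul_eq_mul_left hℓ (Nat.add_left_cancel h)
    have h1 := ((ha z).summable.comp_injective hinj).mul_right
      ((Periodic.qParam 1 (z : ℂ) ^ i.val)⁻¹)
    refine h1.congr fun n ↦ ?_
    simp only [Function.comp_apply, pow_add, pow_mul, h]
    field_simp [Periodic.qParam_ne_zero]
  -- Summability of each residue series at `τ` is inherited from that of `f` at some `z` above `τ`;
  -- `z = τ/ℓ` serves.
  have hroot (τ : ℍ) : ∃ z : ℍ, Periodic.qParam 1 (z : ℂ) ^ ℓ = Periodic.qParam 1 (τ : ℂ) := by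
    refine ⟨ofComplex (((τ : ℂ) + (0 : ℕ)) / ℓ), ?_⟩
    rw [coe_ofComplex_add_div hℓ, Periodic.qParam, Periodic.qParam, ← Complex.exp_nat_mul]
    have hℓ' : (ℓ : ℂ) ≠ 0 := NeZero.ne _
    congr 1
    simp
    field_simp
  refine ⟨fun i ↦ ⟨fun τ ↦ ∑' n, (a.coeff (i.val + ℓ * n) : ℂ) * Periodic.qParam 1 (τ : ℂ) ^ n,
    PowerSeries.mk fun n ↦ a.coeff (i.val + ℓ * n), fun τ ↦ ?_⟩, fun τ z h ↦ ?_⟩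
  · obtain ⟨z, hz⟩ := hroot τ
    simpa using (hsum i τ z hz).hasSum
  · rw [← (ha z).tsum_eq, Nat.sumByResidueClasses (ha z).summable ℓ]
    refine Finset.sum_congr rfl fun i _ ↦ ?_
    rw [← tsum_mul_right]
    refine tsum_congr fun n ↦ ?_
    rw [pow_add, pow_mul, h]
    ring

/-! ### Level one forms with integral `q`-expansion are polynomials in `j` -/

/-- A function with an integral `q`-expansion that transforms correctly under `τ ↦ -1/τ` is a
modular form of level one. -/
lemma exists_modularForm_of_hasIntegralQSeries {g : ℍ → ℂ} {a : PowerSeries ℤ}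
    (hg : HasIntegralQSeries g a) {k : ℤ}
    (hS : ∀ τ : ℍ, g (ModularGroup.S • τ) = (τ : ℂ) ^ k * g τ) :
    ∃ f : ModularForm 𝒮ℒ k, ⇑f = g := by
  have hS' : g ∣[k] ModularGroup.S = g := by
    ext τ
    rw [SL_slash_apply, hS, ModularGroup.denom_S]
    rw [zpow_neg, mul_right_comm, mul_inv_cancel₀ (zpow_ne_zero k τ.ne_zero), one_mul]
  have hT' : g ∣[k] ModularGroup.T = g := by
    ext τ
    rw [SL_slash_apply, modular_T_smul, hg.vadd_one]
    rw [ModularGroup.denom_apply]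
    simp [ModularGroup.T]
  -- `S` and `T` generate `SL₂(ℤ)`; full invariance then reduces boundedness at every cusp to
  -- boundedness at `i∞`.
  have hinv := SlashInvariantForm.slash_action_generators_SL2Z hS' hT'
  refine ⟨{ toFun := g, slash_action_eq' := ?_, holo' := hg.mdifferentiable,
            bdd_at_cusps' := fun hc ↦ ?_ }, rfl⟩
  · rintro _ ⟨γ, rfl⟩
    exact hinv γ
  · rw [Subgroup.IsArithmetic.isCusp_iff_isCusp_SL2Z] at hc
    rw [OnePoint.isBoundedAt_iff_forall_SL2Z hc]
    intro γ _
    rw [hinv γ]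
    exact hg.isBoundedAtImInfty

/-- Induction on the weight: subtracting `a₀ E₄^(3N) = a₀ Δ^N j^N` kills the constant term, and the
difference is `Δ` times a form of weight `12(N - 1)`. The quotient stays integral because `Δ = q u`
with `u` of constant term `1`, hence invertible over `ℤ`. -/
lemma exists_eq_discriminant_pow_mul (N : ℕ) : ∀ {k : ℤ} (_ : k = 12 * N) (f : ModularForm 𝒮ℒ k)
    {a : PowerSeries ℤ} (_ : HasIntegralQSeries f a),
    ∃ P : ℤ[X], ∀ τ, f τ = discriminant τ ^ N * P.eval₂ (Int.castRingHom ℂ) (modularJ τ) := by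
  induction N with
  | zero =>
    rintro k hk f a hf
    obtain rfl : k = 0 := by simpa using hk
    obtain ⟨c, hc⟩ := ModularFormClass.levelOne_weight_zero_const f
    have h0 : (qExpansion 1 f).coeff 0 = c := by
      rw [qExpansion_coeff_zero one_pos
        (ModularFormClass.analyticAt_cuspFunction_zero f one_pos one_mem_strictPeriods_SL)
        (SlashInvariantFormClass.periodic_comp_ofComplex f one_mem_strictPeriods_SL), hc]
      exact tendsto_const_nhds.limUnder_eq
    refine ⟨C (a.coeff 0), fun τ ↦ ?_⟩
    rw [hf.qExpansion_coeff] at h0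
    rw [hc, eval₂_C, pow_zero, one_mul, const_apply, ← h0, Int.coe_castRingHom]
  | succ N ih =>
    rintro k hk f a hf
    have hE : (4 : ℤ) * (3 * (N + 1) : ℕ) = k := by rw [hk]; push_cast; ring
    let e : ModularForm 𝒮ℒ k := ModularForm.mcast (by rw [← hE]; ring) (E₄.pow (3 * (N + 1)))
    have he : ⇑e = ⇑E₄ ^ (3 * (N + 1)) := coe_pow E₄ _
    obtain ⟨d, hd⟩ := exists_hasIntegralQSeries_discriminant
    have hd' : HasIntegralQSeries CuspForm.discriminant d := hd
    have hdq (n : ℕ) : (qExpansion 1 discriminant).coeff n = d.coeff n :=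
      (ModularFormClass.qExpansion_coeff_unique (f := CuspForm.discriminant) one_pos
        one_mem_strictPeriods_SL hd' n).symm
    have hes : HasIntegralQSeries e ((1 + 240 * sigmaSeries 3) ^ (3 * (N + 1))) :=
      he ▸ hasIntegralQSeries_E₄.pow _
    set s := (1 + 240 * sigmaSeries 3) ^ (3 * (N + 1)) with hs
    have hs0 : s.coeff 0 = 1 := by
      simp [hs, sigmaSeries, PowerSeries.coeff_zero_eq_constantCoeff]
    set c := a.coeff 0 with hc
    let g : ModularForm 𝒮ℒ k := f - (c : ℂ) • e
    have hg : HasIntegralQSeries g (a - PowerSeries.C c * s) := fun τ ↦ by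
      simpa [g, sub_mul, mul_assoc, PowerSeries.coeff_C_mul, -eq_intCast] using (hf τ).sub ((hes τ).mul_left (c : ℂ))
    have hg0 : (qExpansion 1 g).coeff 0 = 0 := by
      rw [hg.qExpansion_coeff, map_sub, PowerSeries.coeff_C_mul, hs0]
      simp [hc]
    obtain ⟨b, hb⟩ : (PowerSeries.X : PowerSeries ℤ) ∣ a - PowerSeries.C c * s := by
      rw [PowerSeries.X_dvd_iff, ← PowerSeries.coeff_zero_eq_constantCoeff_apply, map_sub,
        PowerSeries.coeff_C_mul, hs0]
      simp [hc]
    obtain ⟨u, hu⟩ : (PowerSeries.X : PowerSeries ℤ) ∣ d := by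
      rw [PowerSeries.X_dvd_iff, ← PowerSeries.coeff_zero_eq_constantCoeff_apply]
      have := (hdq 0).symm.trans (CuspFormClass.qExpansion_coeff_zero CuspForm.discriminant one_pos
        one_mem_strictPeriods_SL)
      exact_mod_cast this
    have hu1 : PowerSeries.coeff 0 u = 1 := by
      have := (hdq 1).symm.trans discriminant_qExpansion_coeff_one
      rw [hu, ← zero_add 1, PowerSeries.coeff_succ_X_mul] at this
      exact_mod_cast this
    have huu : u * PowerSeries.invOfUnit u 1 = 1 := PowerSeries.mul_invOfUnit u 1 (by simpa using hu1)
    let h := CuspForm.discriminantEquiv (toCuspForm g hg0)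
    have hmul : (a - PowerSeries.C c * s).map (Int.castRingHom ℂ) =
        d.map (Int.castRingHom ℂ) * qExpansion 1 h := by
      convert! qExpansion_eq_qExpansion_discriminant_mul g hg0 using 1
      · ext n; rw [hg.qExpansion_coeff, PowerSeries.coeff_map, Int.coe_castRingHom]
      · congr 1; ext n; simp [hdq]
    have hh : qExpansion 1 h = (PowerSeries.invOfUnit u 1 * b).map (Int.castRingHom ℂ) := by
      rw [hb, hu, map_mul, map_mul, PowerSeries.map_X, mul_assoc] at hmul
      rw [map_mul, mul_left_cancel₀ PowerSeries.X_ne_zero hmul, ← mul_assoc, ← map_mul,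
        mul_comm _ u, huu, map_one, one_mul]
    obtain ⟨P, hP⟩ := ih (by rw [hk]; push_cast; ring) h
      (hasIntegralQSeries_of_coeff h fun n ↦ by rw [hh, PowerSeries.coeff_map, Int.coe_castRingHom])
    refine ⟨C c * X ^ (N + 1) + P, fun τ ↦ ?_⟩
    have h1 : g τ = discriminant τ * h τ :=
      (discriminant_mul_discriminantEquiv_apply (toCuspForm g hg0) τ).symm
    have h2 : g τ = f τ - c * E₄ τ ^ (3 * (N + 1)) := by simp [g, he]
    have h3 : modularJ τ * discriminant τ = E₄ τ ^ 3 :=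
      div_mul_cancel₀ _ (discriminant_ne_zero τ)
    rw [pow_mul, ← h3, mul_pow, h1, hP] at h2
    simp only [eval₂_add, eval₂_mul, eval₂_C, eval₂_X_pow, Int.coe_castRingHom]
    linear_combination -h2

/-! ### Transformation of products over the index `ℓ` sublattices -/

/-- `H` transforms with weight `k` under `SL₂(ℤ)`, the action being given by its graph. -/
def TransformsWithWeight {A : Type*} [CommRing A] [Algebra ℂ A] (k : ℕ) (H : ℍ → A) : Prop :=
  ∀ (a b c d : ℤ) (z w : ℍ), a * d - b * c = 1 →
    (w : ℂ) * (c * (z : ℂ) + d) = a * (z : ℂ) + b →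
    H w = algebraMap ℂ A ((c * (z : ℂ) + d) ^ k) * H z

lemma transformsWithWeight_of_modularForm {k : ℕ} (f : ModularForm 𝒮ℒ k) :
    TransformsWithWeight k f := by
  intro a b c d z w hdet hw
  let γ : SL(2, ℤ) := ⟨!![a, b; c, d], by rw [Matrix.det_fin_two_of, hdet]⟩
  have hden : denom γ z = c * (z : ℂ) + d := by
    rw [ModularGroup.denom_apply]
    simp [γ]
  have hwz : w = γ • z := by
    ext
    rw [UpperHalfPlane.specialLinearGroup_apply]
    have h0 : (c * (z : ℂ) + d) ≠ 0 := by
      rw [← hden]; exact denom_ne_zero _ _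
    simp only [γ]
    simp
    rw [eq_div_iff h0, hw]
  have h := SlashInvariantForm.slash_action_eqn'' f (γ := (γ : GL (Fin 2) ℝ))
    (MonoidHom.mem_range.2 ⟨γ, rfl⟩) z
  rw [hden] at h
  rw [hwz]
  simpa using h

/-- The representative in `[0, ℓ)` of `-k⁻¹` modulo `ℓ`. -/
def negInvMod (ℓ k : ℕ) : ℕ := (-(k : ZMod ℓ)⁻¹).val

/-- The involution `k ↦ k'` describes how `S` permutes the points with `k ≠ 0`; writing `-1 - k k' =
ℓ b`, the matrix `(k, b; ℓ, -k')` has determinant `1`. -/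
lemma negInvMod_mem {ℓ : ℕ} [Fact ℓ.Prime] {k : ℕ} (hk : k ∈ (Finset.range ℓ).erase 0) :
    negInvMod ℓ k ∈ (Finset.range ℓ).erase 0 ∧ negInvMod ℓ (negInvMod ℓ k) = k ∧
      (ℓ : ℤ) ∣ -1 - k * negInvMod ℓ k := by
  obtain ⟨hk0, hk⟩ := Finset.mem_erase.1 hk
  have hkℓ := Finset.mem_range.1 hk
  have hk' : (k : ZMod ℓ) ≠ 0 := by
    rw [Ne, ZMod.natCast_eq_zero_iff]
    exact fun h ↦ absurd (Nat.le_of_dvd (Nat.pos_of_ne_zero hk0) h) (not_le.2 hkℓ)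
  refine ⟨Finset.mem_erase.2 ⟨?_, Finset.mem_range.2 (ZMod.val_lt _)⟩, ?_, ?_⟩
  · rw [negInvMod, Ne, ZMod.val_eq_zero]
    simpa using hk'
  · rw [negInvMod, negInvMod, ZMod.natCast_val, ZMod.cast_id, inv_neg, inv_inv, neg_neg,
      ZMod.val_natCast_of_lt hkℓ]
  · rw [← ZMod.intCast_zmod_eq_zero_iff_dvd]
    push_cast
    rw [negInvMod, ZMod.natCast_val, ZMod.cast_id]
    field_simp
    ring

variable {A : Type*} [CommRing A] [Algebra ℂ A]

/-- The product of the values of `H` at `ℓτ` and at the `(τ + k) / ℓ`. -/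
def heckeProd (ℓ : ℕ) (H : ℍ → A) (τ : ℍ) : A :=
  H (ofComplex (ℓ * (τ : ℂ))) * ∏ k ∈ Finset.range ℓ, H (ofComplex (((τ : ℂ) + k) / ℓ))

/-- `S` exchanges `ℓτ` with `τ/ℓ` and permutes the other points by `k ↦ -1/k` modulo `ℓ`. The
factors `(τ/ℓ)^w`, `(ℓτ)^w` and `ℓ - 1` copies of `τ^w` multiply to `τ^(w(ℓ+1))`. -/
lemma heckeProd_S_smul {ℓ : ℕ} (hℓ : ℓ.Prime) {w : ℕ} {H : ℍ → A}
    (hH : TransformsWithWeight w H) (τ : ℍ) :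
    heckeProd ℓ H (ModularGroup.S • τ) =
      algebraMap ℂ A ((τ : ℂ) ^ (w * (ℓ + 1))) * heckeProd ℓ H τ := by
  have := Fact.mk hℓ
  have hℓ0 : (ℓ : ℂ) ≠ 0 := Nat.cast_ne_zero.2 hℓ.ne_zero
  have hτ0 : (τ : ℂ) ≠ 0 := τ.ne_zero
  have hS : ((ModularGroup.S • τ : ℍ) : ℂ) = -(τ : ℂ)⁻¹ := by
    rw [modular_S_smul]; simp [inv_neg]
  have hmem : 0 ∈ Finset.range ℓ := Finset.mem_range.2 hℓ.pos
  rw [heckeProd, heckeProd, ← Finset.mul_prod_erase _ _ hmem, ← Finset.mul_prod_erase _ _ hmem]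
  set σ := ModularGroup.S • τ
  have h1 : H (ofComplex (ℓ * (σ : ℂ))) =
      algebraMap ℂ A (((τ : ℂ) / ℓ) ^ w) * H (ofComplex (((τ : ℂ) + (0 : ℕ)) / ℓ)) := by
    have := hH 0 (-1) 1 0 (ofComplex (((τ : ℂ) + (0 : ℕ)) / ℓ)) (ofComplex (ℓ * (σ : ℂ))) (by ring)
      (by rw [coe_ofComplex_mul hℓ.pos, coe_ofComplex_add_div hℓ.pos, hS]; push_cast; field_simp
          simp; ring)
    rw [this, coe_ofComplex_add_div hℓ.pos]
    simp
  have h2 : H (ofComplex (((σ : ℂ) + (0 : ℕ)) / ℓ)) =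
      algebraMap ℂ A ((ℓ * (τ : ℂ)) ^ w) * H (ofComplex (ℓ * (τ : ℂ))) := by
    have := hH 0 (-1) 1 0 (ofComplex (ℓ * (τ : ℂ))) (ofComplex (((σ : ℂ) + (0 : ℕ)) / ℓ)) (by ring)
      (by rw [coe_ofComplex_mul hℓ.pos, coe_ofComplex_add_div hℓ.pos, hS]; push_cast; field_simp
          simp)
    rw [this, coe_ofComplex_mul hℓ.pos]
    simp
  have h3 : ∏ k ∈ (Finset.range ℓ).erase 0, H (ofComplex (((σ : ℂ) + k) / ℓ)) =
      algebraMap ℂ A ((τ : ℂ) ^ (w * (ℓ - 1))) *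
        ∏ k ∈ (Finset.range ℓ).erase 0, H (ofComplex (((τ : ℂ) + k) / ℓ)) := by
    have hcard : ((Finset.range ℓ).erase 0).card = ℓ - 1 := by
      rw [Finset.card_erase_of_mem hmem, Finset.card_range]
    rw [pow_mul, map_pow, ← hcard, ← Finset.prod_const, ← Finset.prod_mul_distrib]
    refine Finset.prod_nbij' (negInvMod ℓ) (negInvMod ℓ) (fun k hk ↦ (negInvMod_mem hk).1)
      (fun k hk ↦ (negInvMod_mem hk).1) (fun k hk ↦ (negInvMod_mem hk).2.1)
      (fun k hk ↦ (negInvMod_mem hk).2.1) fun k hk ↦ ?_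
    obtain ⟨b, hb⟩ := (negInvMod_mem hk).2.2
    have hb' : (-1 : ℂ) - k * negInvMod ℓ k = ℓ * b := by exact_mod_cast congrArg (Int.cast (R := ℂ)) hb
    have := hH k b ℓ (-negInvMod ℓ k) (ofComplex (((τ : ℂ) + negInvMod ℓ k) / ℓ))
      (ofComplex (((σ : ℂ) + k) / ℓ)) (by linear_combination hb) (by
        rw [coe_ofComplex_add_div hℓ.pos, coe_ofComplex_add_div hℓ.pos, hS]
        push_cast
        field_simp
        linear_combination (τ : ℂ) * hb')
    have hden : ((ℓ : ℤ) : ℂ) * (((τ : ℂ) + negInvMod ℓ k) / ℓ) + ((-negInvMod ℓ k : ℤ) : ℂ) = τ := by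
      push_cast
      field_simp
      ring
    rw [this, coe_ofComplex_add_div hℓ.pos, hden, map_pow]
  rw [h1, h2, h3]
  have hpow : (τ : ℂ) ^ (w * (ℓ + 1)) =
      ((τ : ℂ) / ℓ) ^ w * (ℓ * (τ : ℂ)) ^ w * (τ : ℂ) ^ (w * (ℓ - 1)) := by
    rw [← mul_pow, show w * (ℓ + 1) = 2 * w + w * (ℓ - 1) by
      obtain ⟨m, rfl⟩ : ∃ m, ℓ = m + 1 := ⟨ℓ - 1, by have := hℓ.pos; omega⟩
      rw [Nat.add_sub_cancel]; ring, pow_add, pow_mul]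
    congr 2
    field_simp
  rw [hpow, map_mul, map_mul]
  ring

/-! ### Existence of the modular polynomial. -/

/-- The linear polynomial `Δ(τ) Y - E₄(τ)³`, with root `j(τ)`. -/
def jPolynomial (τ : ℍ) : ℂ[X] := C (discriminant τ) * X - C (E₄ τ ^ 3)

lemma jPolynomial_eq (τ : ℍ) : jPolynomial τ = C (discriminant τ) * (X - C (modularJ τ)) := by
  rw [jPolynomial, mul_sub, ← C_mul, modularJ, mul_div_cancel₀ _ (discriminant_ne_zero τ)]

lemma transformsWithWeight_jPolynomial : TransformsWithWeight 12 jPolynomial := by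
  intro a b c d z w hdet hw
  have h1 := transformsWithWeight_of_modularForm (k := 4) E₄ a b c d z w hdet hw
  have h2 := transformsWithWeight_of_modularForm (k := 12) CuspForm.discriminant.toModularFormₗ
    a b c d z w hdet hw
  change discriminant w = _ * discriminant z at h2
  simp only [Algebra.algebraMap_self, RingHom.id_apply] at h1 h2
  simp only [jPolynomial, h1, h2, mul_pow, ← pow_mul, Polynomial.algebraMap_apply, Algebra.algebraMap_self,
    RingHom.id_apply, C_mul]
  norm_num
  ring

/-- The coefficients of `∏_k (Δ(z_k) Y - E₄(z_k)³)`, `z_k = (τ + k) / ℓ`, have integral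
`q`-expansions. -/
lemma exists_map_eq_prod_jPolynomial {ℓ : ℕ} (hℓ : 0 < ℓ) :
    ∃ G : integralQSeries[X], ∀ τ, G.map (evalAt τ) =
      ∏ k ∈ Finset.range ℓ, jPolynomial (ofComplex (((τ : ℂ) + k) / ℓ)) := by
  have : NeZero ℓ := ⟨hℓ.ne'⟩
  obtain ⟨d, hd⟩ := exists_residue_decomposition exists_hasIntegralQSeries_discriminant ℓ
  obtain ⟨e, he⟩ := exists_residue_decomposition (f := ⇑E₄ ^ 3) ⟨_, hasIntegralQSeries_E₄.pow 3⟩ ℓ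
  let q : integralQSeries := ⟨fun τ ↦ Periodic.qParam 1 (τ : ℂ), PowerSeries.X, fun τ ↦ by
    convert! hasSum_ite_eq (1 : ℕ) (Periodic.qParam 1 (τ : ℂ)) using 2 with n
    rcases eq_or_ne n 1 with rfl | h <;> simp [PowerSeries.coeff_X, *]⟩
  -- The outer variable stands for `u = q^(1/ℓ)`, and `Q(u)` is `Δ Y - E₄³` at the point with
  -- parameter `u`. The product over all `u` with `u^ℓ = q` is the resultant of `u^ℓ - q` and `Q`,
  -- hence has coefficients in `integralQSeries`.
  let Q : integralQSeries[X][X] := ∑ i : ZMod ℓ, C (C (d i) * X - C (e i)) * X ^ i.val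
  have hQdeg : Q.natDegree ≤ ℓ :=
    natDegree_sum_le_of_forall_le _ _ fun i _ ↦
      (natDegree_C_mul_X_pow_le _ _).trans (ZMod.val_lt i).le
  refine ⟨resultant (X ^ ℓ - C (C q)) Q ℓ ℓ, fun τ ↦ ?_⟩
  let φ : integralQSeries[X] →+* ℂ[X] := mapRingHom (evalAt τ)
  let u : ℕ → ℂ := fun k ↦ Periodic.qParam 1 (ofComplex (((τ : ℂ) + k) / ℓ) : ℂ)
  have hℓ0 : (ℓ : ℂ) ≠ 0 := Nat.cast_ne_zero.2 hℓ.ne'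
  have hu (k : ℕ) : u k = Complex.exp (2 * Real.pi * Complex.I / ℓ) ^ k * u 0 := by
    simp only [u, coe_ofComplex_add_div hℓ, Periodic.qParam]
    rw [← Complex.exp_nat_mul, ← Complex.exp_add]
    congr 1
    push_cast
    field_simp
    ring
  have huℓ (k : ℕ) : u k ^ ℓ = Periodic.qParam 1 (τ : ℂ) := by
    simp only [u, coe_ofComplex_add_div hℓ, Periodic.qParam]
    rw [← Complex.exp_nat_mul, Complex.exp_eq_exp_iff_exists_int]
    refine ⟨k, ?_⟩
    push_cast
    field_simp
  have hprod : (X ^ ℓ - C (C q) : integralQSeries[X][X]).map φ =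
      ∏ k ∈ Finset.range ℓ, (X - C (C (u k))) := by
    have := congrArg (Polynomial.map (C : ℂ →+* ℂ[X]))
      (X_pow_sub_C_eq_prod (Complex.isPrimitiveRoot_exp ℓ hℓ.ne') hℓ (huℓ 0))
    simp only [← hu] at this
    simpa [φ, q, Polynomial.map_prod] using this
  have hdeg : ((X ^ ℓ - C (C q) : integralQSeries[X][X]).map φ).natDegree = ℓ := by
    rw [hprod, natDegree_finsetProd_X_sub_C_eq_card, Finset.card_range]
  change φ _ = _
  have h1 := resultant_prod_left (Finset.range ℓ) (fun k ↦ X - C (C (u k))) (Q.map φ) ℓ (by simp)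
    (natDegree_map_le.trans hQdeg)
  rw [← hprod, hdeg] at h1
  rw [← resultant_map_map, h1]
  refine Finset.prod_congr rfl fun k _ ↦ ?_
  rw [natDegree_X_sub_C, resultant_X_sub_C_left _ _ _ (natDegree_map_le.trans hQdeg)]
  have h2 := hd τ _ (huℓ k)
  have h3 := he τ _ (huℓ k)
  rw [Pi.pow_apply] at h3
  rw [jPolynomial, h2, h3]
  simp only [Q, φ, Polynomial.map_sum, eval_finsetSum, Polynomial.map_mul, Polynomial.map_pow,
    map_X, map_C, eval_mul, eval_pow, eval_X, eval_C, coe_mapRingHom, Polynomial.map_sub,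
    evalAt_apply, map_sum, map_mul, map_pow, Finset.sum_mul, ← Finset.sum_sub_distrib]
  refine Finset.sum_congr rfl fun i _ ↦ ?_
  simp only [u]
  ring

lemma exists_map_eq_heckeProd_jPolynomial {ℓ : ℕ} (hℓ : 0 < ℓ) :
    ∃ G : integralQSeries[X], ∀ τ, G.map (evalAt τ) = heckeProd ℓ jPolynomial τ := by
  obtain ⟨G, hG⟩ := exists_map_eq_prod_jPolynomial hℓ
  let d : integralQSeries := ⟨_, comp_mul_mem_integralQSeries exists_hasIntegralQSeries_discriminant hℓ⟩
  let e : integralQSeries := ⟨_, comp_mul_mem_integralQSeries (f := ⇑E₄ ^ 3)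
    ⟨_, hasIntegralQSeries_E₄.pow 3⟩ hℓ⟩
  refine ⟨(C d * X - C e) * G, fun τ ↦ ?_⟩
  rw [Polynomial.map_mul, hG, heckeProd]
  simp [d, e, jPolynomial]

/-- `Δ(ℓτ) ∏_k Δ((τ + k) / ℓ)` has the same absolute value as `Δ(τ) ^ (ℓ + 1)` in the limit. -/
lemma tendsto_norm_heckeProd_discriminant {ℓ : ℕ} (hℓ : 0 < ℓ) :
    Tendsto (fun τ ↦ ‖heckeProd ℓ discriminant τ / discriminant τ ^ (ℓ + 1)‖) atImInfty (𝓝 1) := by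
  have h0 := tendsto_discriminant_div_qParam.norm
  have h1 := (h0.comp (tendsto_ofComplex_mul hℓ)).mul
    (tendsto_finsetProd (Finset.range ℓ) fun k _ ↦ h0.comp (tendsto_ofComplex_add_div hℓ k))
  have h2 := h1.div (h0.pow (ℓ + 1)) (by simp)
  simp only [norm_one, Finset.prod_const_one, mul_one, one_pow, div_one] at h2
  refine h2.congr fun τ ↦ ?_
  -- The exponents add up to `ℓ + ℓ · (1/ℓ) = ℓ + 1`. Without absolute values this holds only up to
  -- the sign `(-1)^(ℓ-1)`.
  have hq : ‖Periodic.qParam 1 (ofComplex (ℓ * (τ : ℂ)) : ℂ)‖ *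
      ∏ k ∈ Finset.range ℓ, ‖Periodic.qParam 1 (ofComplex (((τ : ℂ) + k) / ℓ) : ℂ)‖ =
      ‖Periodic.qParam 1 (τ : ℂ)‖ ^ (ℓ + 1) := by
    simp only [norm_qParam_one, coe_im, im_ofComplex_mul hℓ, im_ofComplex_add_div hℓ,
      Finset.prod_const, Finset.card_range, ← Real.exp_nat_mul, ← Real.exp_add]
    congr 1
    field_simp
    push_cast
    ring
  simp only [Pi.div_apply, Function.comp_apply, norm_div, norm_mul, norm_pow, norm_prod, heckeProd,
    Finset.prod_div_distrib, div_pow]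
  rw [div_mul_div_comm, hq]
  have : ‖Periodic.qParam 1 (τ : ℂ)‖ ≠ 0 := norm_ne_zero_iff.2 (Periodic.qParam_ne_zero _)
  field_simp

lemma heckeProd_jPolynomial (ℓ : ℕ) (τ : ℍ) :
    heckeProd ℓ jPolynomial τ = C (heckeProd ℓ discriminant τ) *
      heckeProd ℓ (fun z ↦ X - C (modularJ z)) τ := by
  simp only [heckeProd, jPolynomial_eq, Finset.prod_mul_distrib, C_mul, map_prod]
  ring

/-- The modular polynomial of prime level exists. -/
theorem exists_isModularPolynomial {ℓ : ℕ} (hℓ : ℓ.Prime) :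
    ∃ Φ : ℤ[X][Y], IsModularPolynomial ℓ Φ := by
  obtain ⟨G, hG⟩ := exists_map_eq_heckeProd_jPolynomial hℓ.pos
  have hcoeff (m : ℕ) : ∃ P : ℤ[X], ∀ τ, (heckeProd ℓ jPolynomial τ).coeff m =
      discriminant τ ^ (ℓ + 1) * P.eval₂ (Int.castRingHom ℂ) (modularJ τ) := by
    obtain ⟨a, ha⟩ := (G.coeff m).2
    have hval (τ : ℍ) : (G.coeff m).1 τ = (heckeProd ℓ jPolynomial τ).coeff m := by
      rw [← hG, coeff_map, evalAt_apply]
    obtain ⟨f, hf⟩ := exists_modularForm_of_hasIntegralQSeries ha (k := (12 * (ℓ + 1) : ℕ)) fun τ ↦ by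
      rw [hval, hval, heckeProd_S_smul hℓ transformsWithWeight_jPolynomial, Polynomial.algebraMap_apply,
        coeff_C_mul, zpow_natCast]
      rfl
    obtain ⟨P, hP⟩ := exists_eq_discriminant_pow_mul (ℓ + 1) (by push_cast; ring) f (hf ▸ ha)
    exact ⟨P, fun τ ↦ by rw [← hval, ← hf, hP]⟩
  choose P hP using hcoeff
  have hmonic (τ : ℍ) : (heckeProd ℓ (fun z ↦ X - C (modularJ z)) τ).Monic ∧
      (heckeProd ℓ (fun z ↦ X - C (modularJ z)) τ).natDegree = ℓ + 1 := by
    have h1 := monic_X_sub_C (modularJ (ofComplex (ℓ * (τ : ℂ))))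
    have h2 := monic_prod_X_sub_C (fun k : ℕ ↦ modularJ (ofComplex (((τ : ℂ) + k) / ℓ)))
      (Finset.range ℓ)
    refine ⟨h1.mul h2, ?_⟩
    rw [heckeProd, h1.natDegree_mul h2, natDegree_X_sub_C, natDegree_finsetProd_X_sub_C_eq_card]
    simp [add_comm]
  have hlead (τ : ℍ) : heckeProd ℓ discriminant τ =
      discriminant τ ^ (ℓ + 1) * (P (ℓ + 1)).eval₂ (Int.castRingHom ℂ) (modularJ τ) := by
    rw [← hP, heckeProd_jPolynomial, coeff_C_mul]
    have h := (hmonic τ).1.coeff_natDegree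
    rw [(hmonic τ).2] at h
    rw [h, mul_one]
  have hlim : Tendsto (fun τ ↦ ‖(P (ℓ + 1)).eval₂ (Int.castRingHom ℂ) (modularJ τ)‖)
      atImInfty (𝓝 1) :=
    (tendsto_norm_heckeProd_discriminant hℓ.pos).congr fun τ ↦ by
      rw [hlead, mul_div_cancel_left₀ _ (pow_ne_zero _ (discriminant_ne_zero τ))]
  -- A polynomial in `j` that stays bounded at `i∞` is constant; the limit `1` of its absolute value
  -- then leaves only `c = ±1`.
  obtain ⟨c, hc⟩ : ∃ c : ℤ, P (ℓ + 1) = C c := by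
    refine natDegree_eq_zero.1 (Nat.le_zero.1 ?_) |>.imp fun _ h ↦ h.symm
    rw [← natDegree_map_eq_of_injective (f := Int.castRingHom ℂ) Int.cast_injective]
    refine natDegree_le_of_isBigO tendsto_norm_modularJ ?_
    simp only [eval_map, pow_zero]
    exact (isBigO_norm_left.1 (hlim.isBigO_one ℝ)).trans (isBigO_const_const _ one_ne_zero _)
  have hc1 : c * c = 1 := by
    simp only [hc, eval₂_C] at hlim
    have h := tendsto_nhds_unique hlim tendsto_const_nhds
    simp only [Int.coe_castRingHom, Complex.norm_intCast] at h
    have h' : |c| = 1 := by exact_mod_cast h.symm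
    rw [← abs_mul_abs_self, h', one_mul]
  -- Multiplying by `c`, its own inverse, normalises the top coefficient to `1` over `ℤ`.
  refine ⟨∑ m ∈ Finset.range (ℓ + 2), C (C c * P m) * X ^ m, fun τ ↦ ?_⟩
  change _ = heckeProd ℓ (fun z ↦ X - C (modularJ z)) τ
  have hdeg : (heckeProd ℓ jPolynomial τ).natDegree < ℓ + 2 := by
    rw [heckeProd_jPolynomial]
    refine (natDegree_C_mul_le _ _).trans_lt ?_
    rw [(hmonic τ).2]
    omega
  have hΔ := pow_ne_zero (ℓ + 1) (discriminant_ne_zero τ)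
  have hc1' : (c : ℂ) * c = 1 := by exact_mod_cast hc1
  have h1 : C (discriminant τ ^ (ℓ + 1)) * specializeX
      (∑ m ∈ Finset.range (ℓ + 2), C (C c * P m) * X ^ m) (modularJ τ) =
      C (c : ℂ) * heckeProd ℓ jPolynomial τ := by
    conv_rhs => rw [as_sum_range_C_mul_X_pow' _ hdeg]
    simp only [specializeX, Polynomial.map_sum, Polynomial.map_mul, Polynomial.map_pow, map_X,
      map_C, coe_eval₂RingHom, eval₂_C, Int.coe_castRingHom, hP, C_mul, Finset.mul_sum]
    exact Finset.sum_congr rfl fun m _ ↦ by ring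
  have h2 : heckeProd ℓ discriminant τ = discriminant τ ^ (ℓ + 1) * c := by
    rw [hlead, hc, eval₂_C, Int.coe_castRingHom]
  rw [heckeProd_jPolynomial, h2, ← mul_assoc, ← C_mul,
    show (c : ℂ) * (discriminant τ ^ (ℓ + 1) * c) = discriminant τ ^ (ℓ + 1) by
      linear_combination discriminant τ ^ (ℓ + 1) * hc1'] at h1
  exact mul_left_cancel₀ (C_ne_zero.2 hΔ) h1

lemma isModularPolynomial_modularPolynomial {ℓ : ℕ} (hℓ : ℓ.Prime) :
    IsModularPolynomial ℓ (modularPolynomial ℓ) := by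
  rw [modularPolynomial, dif_pos (exists_isModularPolynomial hℓ)]
  exact (exists_isModularPolynomial hℓ).choose_spec

end SupersingularGraph

end

theorem lemma2p9 (p ℓ : ℕ) [Fact p.Prime] (hℓ : ℓ.Prime) (hpℓ : p ≠ ℓ) :
    (∀ j₁ j₂ : SupersingularGraph.Vertex p, SupersingularGraph.HasDoubleEdge p ℓ j₁ j₂ →
      ((SupersingularGraph.doubleEdgePolynomial ℓ).map
        (Int.castRingHom (AlgebraicClosure (ZMod p)))).IsRoot j₁.1) ∧
    (SupersingularGraph.doubleEdgePolynomial ℓ).natDegree ≤ 2 * ℓ * (2 * ℓ - 1) := by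
  have hΦ := SupersingularGraph.isModularPolynomial_modularPolynomial hℓ
  exact ⟨fun _ _ h ↦ SupersingularGraph.isRoot_resultant_derivative hΦ.monic.1 h,
    hΦ.natDegree_resultant_le' hℓ.pos⟩
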